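/- **Conventions.** A language is a set of operation symbols of finite positive arity (constants are replaced by unary operations). A logic $\vdash$ is a substitution invariant consequence relation (possibly infinitary) on the set of formulas of a language $\mathscr{L}_\vdash$ over an infinite set of variables. For an $\mathscr{L}_\vdash$-algebra $\mathbf{A}$ (with non-empty universe $A$) and $F\subseteq A$, write $\langle \mathbf{A},F\rangle\in\mathsf{Mod}(\vdash)$, and call $F$ a deductive filter of $\vdash$ on $\mathbf{A}$, if $\Gamma\vdash\varphi$ and $h[\Gamma]\subseteq F$ imply $h(\varphi)\in F$ for all homomorphisms $h$ from the formula algebra to $\mathbf{A}$. The Leibniz congruence $\Omega^{\mathbf{A}}F$ is the largest congruence of $\mathbf{A}$ that relates no element of $F$ with an element of $A\smallsetminus F$, and $\mathsf{Mod}^{\equiv}(\vdash)$ is the class of all $\langle\mathbf{A},F\rangle\in\mathsf{Mod}(\vdash)$ such that $\bigcap\{\Omega^{\mathbf{A}}G : G\supseteq F,\ G \text{ a deductive filter of }\vdash\text{ on }\mathbf{A}\}$ is the identity relation. A translation $\tau$ of $\mathscr{L}$ into $\mathscr{L}'$ assigns to each $n$-ary symbol of $\mathscr{L}$ an $n$-ary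 term of $\mathscr{L}'$; it turns every $\mathscr{L}'$-algebra $\mathbf{A}$ into an $\mathscr{L}$-algebra $\mathbf{A}^{\tau}$. It is an interpretation of $\vdash$ into $\vdash'$ if $\langle\mathbf{A},F\rangle\in\mathsf{Mod}^{\equiv}(\vdash')$ implies $\langle\mathbf{A}^{\tau},F\rangle\in\mathsf{Mod}^{\equiv}(\vdash)$. Write ${\vdash}\leq{\vdash'}$ if such an interpretation exists, and let $\mathsf{Log}$ be the poset induced by the preorder $\leq$ on logics. A logic $\vdash$ is meet-prime if its class $a$ in $\mathsf{Log}$ is meet-prime, i.e. for all $b,c\in\mathsf{Log}$, $b\wedge c\leq a$ implies $b\leq a$ or $c\leq a$ (here $b\wedge c\leq a$ means that every common lower bound of $b$ and $c$ is below $a$). A Leibniz condition is a sequence $\Phi=\{\vdash_{\Phi_\alpha}\}$ of logics indexed by all ordinals such that ${\vdash_{\Phi_\beta}}\leq{\vdash_{\Phi_\alpha}}$ whenever $\alpha\leq\beta$; $\mathrm{Log}(\Phi)$ is the class of logics $\vdash$ with ${\vdash_{\Phi_\alpha}}\leq{\vdash}$ for some $\alpha$. A logic $\vdash$ is protoalgebraic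 if there is a non-empty set $\Delta(x,y,\vec z)$ of formulas such that for all $\langle\mathbf{A},F\rangle\in\mathsf{Mod}(\vdash)$ and $a,b\in A$: $\langle a,b\rangle\in\Omega^{\mathbf{A}}F$ iff $\Delta^{\mathbf{A}}(a,b,\vec c)\subseteq F$ for all $\vec c\in A$. For an infinite cardinal $\kappa$, the basic protoalgebraic logic $\vdash_{\mathsf P}^{\kappa}$ of rank $\kappa$ has binary symbols $\multimap_\alpha$ ($\alpha<\kappa$) and $n$-ary symbols $\ast_{n\alpha}$ ($\alpha<\kappa$) for each integer $n\geq 1$. It is formulated with countably many variables and is determined by the rules $\emptyset\rhd x\multimap_\alpha x$ ($\alpha<\kappa$) and $\{x\}\cup\{x\multimap_\alpha y:\alpha<\kappa\}\rhd y$. **Theorem.** For every infinite cardinal $\kappa$, the logic $\vdash_{\mathsf P}^{\kappa}$ is meet-prime. Consequently, the class of protoalgebraic logics has the form $\mathrm{Log}(\Phi)$ for some Leibniz condition $\Phi$ consisting of meet-prime logics. -/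

import Mathlib

universe u v w

namespace LeibnizHierarchy

/-! ## Languages, formulas, algebras -/

/-- An algebraic language: a set of operation symbols of finite positive arity.  There are no
constant symbols; a constant is treated as a unary operation that happens to be constant. -/
structure Language : Type (u + 1) where
  Op : Type u
  arity : Op → ℕ
  arity_pos : ∀ f, 0 < arity f

/-- Formulas (terms) of the language `L` with variables in `X`. -/
inductive Fm (L : Language.{u}) (X : Type v) : Type (max u v)
  | var : X → Fm L X
  | app : (f : L.Op) → (Fin (L.arity f) → Fm L X) → Fm L X

/-- An `L`-algebra structure on `A`: an interpretation of every operation symbol. -/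
abbrev Alg (L : Language.{u}) (A : Type v) : Type (max u v) :=
  (f : L.Op) → (Fin (L.arity f) → A) → A

/-- The value of a formula under an assignment `v` of the variables, that is, the unique
homomorphism from the formula algebra to `𝒜` that extends `v`. -/
def Fm.eval {L : Language.{u}} {X : Type v} {A : Type w} (𝒜 : Alg L A) (v : X → A) :
    Fm L X → A
  | .var x => v x
  | .app f t => 𝒜 f (fun i => (t i).eval 𝒜 v)

/-- Substitutions are the homomorphisms between formula algebras. -/
def Fm.subst {L : Language.{u}} {X : Type v} {Y : Type w} (σ : X → Fm L Y) (φ : Fm L X) :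
    Fm L Y :=
  φ.eval (fun f t => Fm.app f t) σ

theorem Fm.eval_subst {L : Language.{u}} {X Y : Type*} {A : Type*} (𝒜 : Alg L A)
    (v : Y → A) (σ : X → Fm L Y) (φ : Fm L X) :
    (φ.subst σ).eval 𝒜 v = φ.eval 𝒜 (fun x => (σ x).eval 𝒜 v) := by
  induction φ with
  | var x => rfl
  | app f t ih =>
    change 𝒜 f _ = 𝒜 f _
    congr 1
    funext i
    exact ih i

theorem Fm.subst_subst {L : Language.{u}} {X Y Z : Type*} (ρ : X → Fm L Y) (σ : Y → Fm L Z)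
    (φ : Fm L X) : (φ.subst ρ).subst σ = φ.subst (fun x => (ρ x).subst σ) :=
  Fm.eval_subst _ σ ρ φ

/-! ## Logics -/

/-- A (propositional) logic: a substitution invariant consequence relation, possibly infinitary,
on the set of formulas of some language over some infinite set of variables. -/
structure Logic : Type (u + 1) where
  L : Language.{u}
  Var : Type u
  infinite_var : Infinite Var
  Entails : Set (Fm L Var) → Fm L Var → Prop
  entails_of_mem : ∀ {Γ : Set (Fm L Var)} {φ : Fm L Var}, φ ∈ Γ → Entails Γ φ
  cut : ∀ {Γ Δ : Set (Fm L Var)} {φ : Fm L Var},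
    (∀ ψ ∈ Δ, Entails Γ ψ) → Entails Δ φ → Entails Γ φ
  entails_subst : ∀ {Γ : Set (Fm L Var)} {φ : Fm L Var} (σ : Var → Fm L Var),
    Entails Γ φ → Entails (Fm.subst σ '' Γ) (φ.subst σ)

/-- Derivability from the premises `Γ` by means of the rules `Γ' ▷ φ` with `(Γ', φ) ∈ R`:
derivations are well-founded trees, as rules may have infinitely many premises. -/
inductive Derives {L : Language.{u}} {X : Type u} (R : Set (Set (Fm L X) × Fm L X))
    (Γ : Set (Fm L X)) : Fm L X → Prop
  | hyp {φ : Fm L X} : φ ∈ Γ → Derives R Γ φ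
  | rule {r : Set (Fm L X) × Fm L X} (σ : X → Fm L X) : r ∈ R →
      (∀ δ ∈ r.1, Derives R Γ (δ.subst σ)) → Derives R Γ (r.2.subst σ)

/-- The logic determined by a set of rules. -/
def Logic.ofRules (L : Language.{u}) (X : Type u) (hX : Infinite X)
    (R : Set (Set (Fm L X) × Fm L X)) : Logic.{u} where
  L := L
  Var := X
  infinite_var := hX
  Entails := Derives R
  entails_of_mem := Derives.hyp
  cut := by
    intro Γ Δ φ h1 h2
    induction h2 with
    | hyp h => exact h1 _ h
    | rule σ hr _ ih => exact Derives.rule σ hr ih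
  entails_subst := by
    intro Γ φ σ h
    induction h with
    | hyp h => exact Derives.hyp (Set.mem_image_of_mem _ h)
    | rule ρ hr _ ih =>
      rw [Fm.subst_subst]
      refine Derives.rule _ hr fun δ hδ => ?_
      rw [← Fm.subst_subst]
      exact ih δ hδ

/-! ## Matrices and models -/

/-- `F` is a deductive filter of the logic `𝓢` on the algebra `𝒜`; equivalently, the matrix
`⟨𝒜, F⟩` belongs to `Mod(𝓢)`. -/
def Logic.IsModel (𝓢 : Logic.{u}) {A : Type v} (𝒜 : Alg 𝓢.L A) (F : Set A) : Prop :=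
  ∀ (Γ : Set (Fm 𝓢.L 𝓢.Var)) (φ : Fm 𝓢.L 𝓢.Var), 𝓢.Entails Γ φ →
    ∀ v : 𝓢.Var → A, (∀ γ ∈ Γ, γ.eval 𝒜 v ∈ F) → φ.eval 𝒜 v ∈ F

/-- The equivalence relation `θ` is a congruence of `𝒜`. -/
def IsCongruence {L : Language.{u}} {A : Type v} (𝒜 : Alg L A) (θ : Setoid A) : Prop :=
  ∀ (f : L.Op) (a b : Fin (L.arity f) → A), (∀ i, θ (a i) (b i)) → θ (𝒜 f a) (𝒜 f b)

/-- The Leibniz congruence of `F` on `𝒜`: the largest congruence of `𝒜` compatible with `F`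
(one that never relates a member of `F` with a non-member), given as the union of all of them. -/
def Leibniz {L : Language.{u}} {A : Type v} (𝒜 : Alg L A) (F : Set A) (a b : A) : Prop :=
  ∃ θ : Setoid A, IsCongruence 𝒜 θ ∧ (∀ c d, θ c d → c ∈ F → d ∈ F) ∧ θ a b

/-- The Suszko congruence of `F` on `𝒜` relative to `𝓢`: the intersection of the Leibniz
congruences of all deductive filters of `𝓢` on `𝒜` that extend `F`. -/
def Logic.Suszko (𝓢 : Logic.{u}) {A : Type v} (𝒜 : Alg 𝓢.L A) (F : Set A) (a b : A) : Prop :=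
  ∀ G : Set A, 𝓢.IsModel 𝒜 G → F ⊆ G → Leibniz 𝒜 G a b

/-- The matrix `⟨𝒜, F⟩` belongs to `Mod^≡(𝓢)`: it is a model of `𝓢` whose Suszko congruence is
the identity relation. -/
def Logic.IsReducedModel (𝓢 : Logic.{u}) {A : Type v} (𝒜 : Alg 𝓢.L A) (F : Set A) : Prop :=
  𝓢.IsModel 𝒜 F ∧ ∀ a b : A, 𝓢.Suszko 𝒜 F a b → a = b

/-! ## Interpretations and the poset of all logics -/

/-- A translation of `L` into `L'` assigns to every `n`-ary symbol of `L` an `n`-ary term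
of `L'`. -/
abbrev Translation (L L' : Language.{u}) : Type u :=
  (f : L.Op) → Fm L' (Fin (L.arity f))

/-- The `L`-algebra `𝒜^τ` induced by an `L'`-algebra `𝒜` along a translation `τ`. -/
def Alg.reduct {L L' : Language.{u}} {A : Type v} (τ : Translation L L') (𝒜 : Alg L' A) :
    Alg L A :=
  fun f a => (τ f).eval 𝒜 a

/-- The extension of a translation to all formulas. -/
def Fm.translate {L L' : Language.{u}} {X : Type v} (τ : Translation L L') : Fm L X → Fm L' X
  | .var x => .var x
  | .app f t => (τ f).subst (fun i => (t i).translate τ)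

theorem Fm.eval_translate {L L' : Language.{u}} {X : Type*} {A : Type*} (τ : Translation L L')
    (𝒜 : Alg L' A) (v : X → A) (φ : Fm L X) :
    (φ.translate τ).eval 𝒜 v = φ.eval (Alg.reduct τ 𝒜) v := by
  induction φ with
  | var x => rfl
  | app f t ih =>
    change ((τ f).subst fun i => (t i).translate τ).eval 𝒜 v = _
    rw [Fm.eval_subst]
    change _ = (τ f).eval 𝒜 _
    congr 1
    funext i
    exact ih i

/-- `τ` is an interpretation of `𝓢` into `𝓣`: whenever `⟨𝒜, F⟩ ∈ Mod^≡(𝓣)`, also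
`⟨𝒜^τ, F⟩ ∈ Mod^≡(𝓢)`. -/
def IsInterpretation (𝓢 𝓣 : Logic.{u}) (τ : Translation 𝓢.L 𝓣.L) : Prop :=
  ∀ (A : Type u) [Nonempty A] (𝒜 : Alg 𝓣.L A) (F : Set A),
    𝓣.IsReducedModel 𝒜 F → 𝓢.IsReducedModel (Alg.reduct τ 𝒜) F

/-- The interpretability preorder: `𝓢 ≤ 𝓣` when there is an interpretation of `𝓢` into `𝓣`. -/
instance : Preorder Logic.{u} where
  le 𝓢 𝓣 := ∃ τ : Translation 𝓢.L 𝓣.L, IsInterpretation 𝓢 𝓣 τ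
  le_refl 𝓢 := ⟨fun f => .app f .var, fun _ _ _ _ h => h⟩
  le_trans 𝓢 𝓣 𝓤 := by
    rintro ⟨τ, hτ⟩ ⟨ρ, hρ⟩
    refine ⟨fun f => (τ f).translate ρ, fun A _ 𝒜 F h => ?_⟩
    have key : Alg.reduct (fun f => (τ f).translate ρ) 𝒜
        = Alg.reduct τ (Alg.reduct ρ 𝒜) := by
      funext f a
      exact Fm.eval_translate ρ 𝒜 a (τ f)
    rw [key]
    exact hτ A _ F (hρ A 𝒜 F h)

/-- The poset `Log` of all logics: logics modulo equi-interpretability, ordered by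
interpretability. -/
abbrev Log : Type (u + 1) := Antisymmetrization Logic.{u} (· ≤ ·)

/-- The element of `Log` represented by a logic. -/
def Logic.toLog (𝓢 : Logic.{u}) : Log.{u} := toAntisymmetrization (· ≤ ·) 𝓢

/-- Meet-prime elements of a poset: if the meet of `b` and `c` is below `a`, then `b ≤ a` or
`c ≤ a`.  That the meet of `b` and `c` is below `a` is expressed by saying that all common
lower bounds of `b` and `c` are, so that the definition does not rest on a choice of meets. -/
def IsMeetPrime {P : Type v} [PartialOrder P] (a : P) : Prop :=
  ∀ b c : P, (∀ d, d ≤ b → d ≤ c → d ≤ a) → b ≤ a ∨ c ≤ a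

/-- In a meet-semilattice this is the usual definition of meet-prime elements. -/
theorem isMeetPrime_iff {P : Type v} [SemilatticeInf P] (a : P) :
    IsMeetPrime a ↔ ∀ b c : P, b ⊓ c ≤ a → b ≤ a ∨ c ≤ a :=
  ⟨fun h b c hbc => h b c fun _ h1 h2 => (le_inf h1 h2).trans hbc,
    fun h b c hbc => h b c (hbc _ inf_le_left inf_le_right)⟩

/-- A logic is meet-prime when its class in `Log` is. -/
def Logic.MeetPrime (𝓢 : Logic.{u}) : Prop := IsMeetPrime 𝓢.toLog

/-! ## Leibniz conditions -/

/-- A Leibniz condition: a sequence of logics, indexed by all ordinals, which is decreasing with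
respect to interpretability. -/
structure LeibnizCondition : Type (u + 1) where
  seq : Ordinal.{u} → Logic.{u}
  anti : ∀ α β, α ≤ β → seq β ≤ seq α

/-- `Log(Φ)`, the class of logics that satisfy the Leibniz condition `Φ`. -/
def LeibnizCondition.logics (Φ : LeibnizCondition.{u}) : Set Logic.{u} :=
  {𝓢 | ∃ α, Φ.seq α ≤ 𝓢}

/-! ## Protoalgebraic logics -/

/-- A logic is protoalgebraic if it has a non-empty set `Δ(x, y, z⃗)` of congruence formulas with
parameters: in all models, the Leibniz congruence relates `a` and `b` if and only if all formulas
in `Δ(a, b, c⃗)` hold for all values `c⃗` of the remaining variables. -/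
def Logic.Protoalgebraic (𝓢 : Logic.{u}) : Prop :=
  ∃ (x y : 𝓢.Var) (Δ : Set (Fm 𝓢.L 𝓢.Var)), x ≠ y ∧ Δ.Nonempty ∧
    ∀ (A : Type u) [Nonempty A] (𝒜 : Alg 𝓢.L A) (F : Set A), 𝓢.IsModel 𝒜 F →
      ∀ a b : A, Leibniz 𝒜 F a b ↔
        ∀ v : 𝓢.Var → A, v x = a → v y = b → ∀ δ ∈ Δ, δ.eval 𝒜 v ∈ F

/-- The symbols of the language of rank `κ`, with index set `K` of size `κ`: binary symbols
`⊸_α` (`imp α`), and for every `n` symbols `*_{n+1, α}` (`star n α`) of arity `n + 1`. -/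
inductive ProtoOp (K : Type u) : Type u
  | imp : K → ProtoOp K
  | star : ℕ → K → ProtoOp K

/-- The language with the symbols `ProtoOp K`. -/
def protoLanguage (K : Type u) : Language.{u} where
  Op := ProtoOp K
  arity
    | .imp _ => 2
    | .star n _ => n + 1
  arity_pos
    | .imp _ => Nat.zero_lt_two
    | .star n _ => n.succ_pos

/-- The formula `φ ⊸_α ψ`. -/
def protoImp {K : Type u} {X : Type v} (α : K) (φ ψ : Fm (protoLanguage K) X) :
    Fm (protoLanguage K) X :=
  Fm.app (L := protoLanguage K) (ProtoOp.imp α) ![φ, ψ]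

/-- The set `∇(φ, ψ) = {φ ⊸_α ψ : α ∈ K}`. -/
def protoNabla {K : Type u} {X : Type v} (φ ψ : Fm (protoLanguage K) X) :
    Set (Fm (protoLanguage K) X) :=
  Set.range fun α => protoImp α φ ψ

/-- The rules `∅ ▷ ∇(x, x)` (one rule for each formula in `∇(x, x)`) and `x, ∇(x, y) ▷ y`. -/
def protoRules {K : Type u} {X : Type u} (x y : X) :
    Set (Set (Fm (protoLanguage K) X) × Fm (protoLanguage K) X) :=
  {r | (r.1 = ∅ ∧ r.2 ∈ protoNabla (.var x) (.var x)) ∨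
    r = (insert (.var x) (protoNabla (.var x) (.var y)), .var y)}

/-- The basic protoalgebraic logic of rank `κ`, formulated with countably many variables; the
indices `α < κ` are the elements of `κ.ord.ToType`. -/
noncomputable def basicProto (κ : Cardinal.{u}) : Logic.{u} :=
  Logic.ofRules (protoLanguage κ.ord.ToType) (ULift.{u} ℕ) inferInstance
    (protoRules ⟨0⟩ ⟨1⟩)

end LeibnizHierarchy

/-! Meet-primality. Two logics have their non-indexed product as a common lower bound, so if all
common lower bounds are below `𝓟`, some `τ` interprets the product into `𝓟`. The product language
has a binary symbol `mixOp` taking one component from its first argument and the other from its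
second. It is idempotent in every product algebra, hence in all reduced models of the product logic,
so its translation is an idempotent binary term of `𝓟`. For a basic protoalgebraic logic such a term
is a variable: the formulas `φ ⊸_α φ` give a reduced model on a formula algebra, where `t(x, x) = x`
leaves no other choice. So the translated `mixOp` is a projection, one component becomes redundant,
and the other factor is interpreted in `𝓟` (`Logic.meetPrime_of_idempotent`,
`isReducedModel_formulas`).

The Leibniz condition is the sequence of the basic logics of rank `ℵ_α`. Above such a logic, the
implications applied to `φ(x, z⃗)` and `φ(y, z⃗)`, in both directions, define Leibniz congruences,
since these are described by unary polynomials. Conversely, in a protoalgebraic logic the binary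
terms with `t(x, x)` a theorem satisfy modus ponens. A large enough rank lets `⊸_α` enumerate them,
while the symbols `∗` enumerate all terms; the latter ensures that the reduct has no new
congruences, so that reduced models stay reduced. -/

namespace LeibnizHierarchy

/-! ## Variables and renamings -/

/-- The set of variables that occur in a formula. -/
def Fm.vars {L : Language.{u}} {X : Type v} : Fm L X → Set X
  | .var x => {x}
  | .app _ t => ⋃ i, (t i).vars

theorem Fm.finite_vars {L : Language.{u}} {X : Type v} (φ : Fm L X) : φ.vars.Finite := by
  induction φ with
  | var x => exact Set.finite_singleton x
  | app f t ih => exact Set.finite_iUnion ih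

theorem Fm.eval_congr {L : Language.{u}} {X : Type v} {A : Type w} (𝒜 : Alg L A) {v v' : X → A}
    {φ : Fm L X} (h : ∀ x ∈ φ.vars, v x = v' x) : φ.eval 𝒜 v = φ.eval 𝒜 v' := by
  induction φ with
  | var x => exact h x rfl
  | app f t ih =>
    change 𝒜 f _ = 𝒜 f _
    congr 1
    funext i
    exact ih i fun x hx => h x (Set.mem_iUnion.2 ⟨i, hx⟩)

/-- Finitely many variables can be renamed into an infinite set, outside a given finite set,
without changing their values. -/
theorem exists_renaming {X Y A : Type*} [Infinite X] {S : Set Y} (hS : S.Finite) {T : Set X}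
    (hT : T.Finite) (v : Y → A) (w : X → A) :
    ∃ (e : Y → X) (v' : X → A), (∀ s ∈ S, v' (e s) = v s) ∧ ∀ x ∈ T, v' x = w x := by
  classical
  obtain ⟨g, hg⟩ := Set.countable_iff_exists_injOn.1 hS.countable
  have : Infinite ↥(Tᶜ) := hT.infinite_compl.to_subtype
  let ι := Infinite.natEmbedding ↥(Tᶜ)
  let e : Y → X := fun y => (ι (g y) : X)
  have he : Set.InjOn e S := fun a ha b hb hab =>
    hg ha hb (ι.injective (Subtype.ext hab))
  refine ⟨e, fun x => if h : ∃ s ∈ S, e s = x then v h.choose else w x, ?_, ?_⟩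
  · intro s hs
    have h : ∃ s' ∈ S, e s' = e s := ⟨s, hs, rfl⟩
    simp only [dif_pos h]
    rw [he h.choose_spec.1 hs h.choose_spec.2]
  · intro x hx
    have h : ¬ ∃ s ∈ S, e s = x := by
      rintro ⟨s, -, rfl⟩
      exact (ι (g s)).2 hx
    simp only [dif_neg h]

/-- The variable set `Y` may be larger than that of `𝓢`, for instance the universe of an algebra.
Only finitely many variables occur in `s` and `t`, so they can be renamed into those of `𝓢`. -/
theorem Logic.IsModel.mem_of_entails {𝓢 : Logic.{u}} {A : Type v} {Y : Type w}
    {𝒜 : Alg 𝓢.L A} {F : Set A} (hF : 𝓢.IsModel 𝒜 F) {s t : Fm 𝓢.L Y}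
    (hst : ∀ e : Y → 𝓢.Var,
      𝓢.Entails {s.subst fun y => .var (e y)} (t.subst fun y => .var (e y)))
    (v : Y → A) (hs : s.eval 𝒜 v ∈ F) : t.eval 𝒜 v ∈ F := by
  have := 𝓢.infinite_var
  obtain ⟨e, v', hv', -⟩ := exists_renaming (X := 𝓢.Var)
    (s.finite_vars.union t.finite_vars) Set.finite_empty v (fun _ => s.eval 𝒜 v)
  have key : ∀ φ : Fm 𝓢.L Y, φ.vars ⊆ s.vars ∪ t.vars →
      (φ.subst fun y => (.var (e y) : Fm 𝓢.L 𝓢.Var)).eval 𝒜 v' = φ.eval 𝒜 v := by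
    intro φ hφ
    rw [Fm.eval_subst]
    exact Fm.eval_congr _ fun x hx => hv' x (hφ hx)
  rw [← key t Set.subset_union_right]
  refine hF _ _ (hst e) v' ?_
  rintro γ rfl
  rw [key s Set.subset_union_left]
  exact hs

/-! ## Congruences and quotients -/

section Congruence

variable {L : Language.{u}} {A : Type v} {𝒜 : Alg L A} {θ : Setoid A} {F : Set A}

theorem IsCongruence.eval (h : IsCongruence 𝒜 θ) {X : Type w} {v v' : X → A}
    (hv : ∀ x, θ (v x) (v' x)) (φ : Fm L X) : θ (φ.eval 𝒜 v) (φ.eval 𝒜 v') := by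
  induction φ with
  | var x => exact hv x
  | app f t ih => exact h f _ _ ih

theorem IsCongruence.of_terms {L' : Language.{u}} {ℬ : Alg L' A} (h : IsCongruence ℬ θ)
    (ht : ∀ f : L.Op, ∃ t : Fm L' (Fin (L.arity f)), ∀ a, 𝒜 f a = t.eval ℬ a) :
    IsCongruence 𝒜 θ := by
  intro f a b hab
  obtain ⟨t, ht⟩ := ht f
  rw [ht, ht]
  exact h.eval hab t

variable (𝒜 F) in
/-- The Leibniz congruence, described by the unary polynomials of the algebra. -/
def leibnizSetoid : Setoid A where
  r a b := ∀ φ : Fm L (Option A),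
    φ.eval 𝒜 (fun o => o.elim a id) ∈ F ↔ φ.eval 𝒜 (fun o => o.elim b id) ∈ F
  iseqv := by
    exact ⟨fun _ _ => Iff.rfl, fun h φ => (h φ).symm, fun h h' φ => (h φ).trans (h' φ)⟩

variable (𝒜 F) in
theorem isCongruence_leibnizSetoid : IsCongruence 𝒜 (leibnizSetoid 𝒜 F) := by
  classical
  intro f a b hab
  -- Arguments are exchanged one at a time; each exchange is absorbed into the polynomial `ψ`, in
  -- which the exchanged argument is the hole.
  have key : ∀ s : Finset (Fin (L.arity f)),
      leibnizSetoid 𝒜 F (𝒜 f a) (𝒜 f fun i => if i ∈ s then b i else a i) := by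
    intro s
    induction s using Finset.induction_on with
    | empty => simp
    | insert j s hj ih =>
      refine (leibnizSetoid 𝒜 F).trans ih fun φ => ?_
      let c : Fin (L.arity f) → A := fun i => if i ∈ s then b i else a i
      let ψ : Fm L (Option A) := φ.subst fun o => o.elim
        (.app f fun i => if i = j then .var none else .var (some (c i))) (fun x => .var (some x))
      have hψ : ∀ d : A, ψ.eval 𝒜 (fun o => o.elim d id)
          = φ.eval 𝒜 (fun o => o.elim (𝒜 f fun i => if i = j then d else c i) id) := by
        intro d
        rw [Fm.eval_subst]
        congr 1
        funext o
        cases o with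
        | some x => rfl
        | none =>
          change 𝒜 f _ = 𝒜 f _
          congr 1
          funext i
          by_cases hi : i = j <;> simp [hi, Fm.eval]
      have h := hab j ψ
      rw [hψ, hψ] at h
      have ha : (fun i => if i = j then a j else c i) = c := by
        funext i
        by_cases hi : i = j
        · subst hi; simp [c, hj]
        · simp [hi]
      have hb : (fun i => if i = j then b j else c i)
          = fun i => if i ∈ insert j s then b i else a i := by
        funext i
        by_cases hi : i = j
        · subst hi; simp
        · simp [hi, c]
      rwa [ha, hb] at h
  simpa using key Finset.univ

theorem mem_of_leibnizSetoid {a b : A} (h : leibnizSetoid 𝒜 F a b) (ha : a ∈ F) : b ∈ F :=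
  (h (.var none)).1 ha

theorem leibniz_iff {a b : A} : Leibniz 𝒜 F a b ↔ leibnizSetoid 𝒜 F a b := by
  constructor
  · rintro ⟨θ, hθ, hF, hab⟩ φ
    have h : θ (φ.eval 𝒜 fun o => o.elim a id) (φ.eval 𝒜 fun o => o.elim b id) := by
      refine hθ.eval (fun o => ?_) φ
      cases o with
      | none => exact hab
      | some x => exact θ.refl _
    exact ⟨hF _ _ h, hF _ _ (θ.symm h)⟩
  · exact fun h => ⟨_, isCongruence_leibnizSetoid 𝒜 F, fun _ _ => mem_of_leibnizSetoid, h⟩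

variable (𝒜 θ) in
/-- The quotient of an algebra by a congruence. -/
noncomputable def Alg.quotient : Alg L (Quotient θ) :=
  fun f t => ⟦𝒜 f fun i => (t i).out⟧

theorem IsCongruence.eval_quotient (h : IsCongruence 𝒜 θ) {X : Type w} (v : X → A)
    (φ : Fm L X) : φ.eval (Alg.quotient 𝒜 θ) (fun x => ⟦v x⟧) = ⟦φ.eval 𝒜 v⟧ := by
  induction φ with
  | var x => rfl
  | app f t ih =>
    refine Quotient.sound (h f _ _ fun i => ?_)
    change θ (Quotient.out (Fm.eval _ _ (t i))) _
    rw [ih i]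
    exact Quotient.mk_out _

/-- The reduction of a model is a reduced model. -/
theorem Logic.IsModel.quotient {𝓢 : Logic.{u}} {𝒜 : Alg 𝓢.L A} (hF : 𝓢.IsModel 𝒜 F) :
    𝓢.IsReducedModel (Alg.quotient 𝒜 (leibnizSetoid 𝒜 F)) {q | q.out ∈ F} := by
  have hc := isCongruence_leibnizSetoid 𝒜 F
  have hmem : ∀ a : A, (⟦a⟧ : Quotient (leibnizSetoid 𝒜 F)) ∈ {q | q.out ∈ F}
      ↔ a ∈ F := fun a =>
    ⟨mem_of_leibnizSetoid (Quotient.mk_out a),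
      mem_of_leibnizSetoid ((leibnizSetoid 𝒜 F).symm (Quotient.mk_out a))⟩
  have hmodel : 𝓢.IsModel (Alg.quotient 𝒜 (leibnizSetoid 𝒜 F)) {q | q.out ∈ F} := by
    intro Γ φ hφ v hv
    obtain ⟨w, rfl⟩ : ∃ w : 𝓢.Var → A, v = fun x => ⟦w x⟧ :=
      ⟨fun x => (v x).out, funext fun x => (Quotient.out_eq _).symm⟩
    rw [hc.eval_quotient, hmem]
    refine hF Γ φ hφ w fun γ hγ => ?_
    rw [← hmem, ← hc.eval_quotient]
    exact hv γ hγ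
  refine ⟨hmodel, fun q r hqr => ?_⟩
  -- The Suszko congruence lies inside the Leibniz congruence of the filter itself, and a compatible
  -- congruence of the quotient pulls back to one of `𝒜`.
  obtain ⟨θ, hθ, hθF, h⟩ := hqr _ hmodel subset_rfl
  induction q using Quotient.inductionOn with | _ a
  induction r using Quotient.inductionOn with | _ b
  refine Quotient.sound (leibniz_iff.1
    ⟨θ.comap fun x => ⟦x⟧, ?_, fun c d hcd hc => (hmem d).1 (hθF _ _ hcd ((hmem c).2 hc)), h⟩)
  intro f x y hxy
  have := hθ.eval hxy (.app f .var)
  rwa [hc.eval_quotient, hc.eval_quotient] at this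

/-- If all operations of `𝒜` are term operations of `ℬ` and the filters of `𝓢` on `𝒜` above `F`
are filters of `𝓣` on `ℬ`, then a reduced model of `𝓢` yields one of `𝓣`. -/
theorem Logic.IsReducedModel.of_terms {𝓢 𝓣 : Logic.{u}} {𝒜 : Alg 𝓢.L A} {ℬ : Alg 𝓣.L A}
    (hF : 𝓢.IsReducedModel 𝒜 F)
    (hm : ∀ G, 𝓢.IsModel 𝒜 G → F ⊆ G → 𝓣.IsModel ℬ G)
    (ht : ∀ f : 𝓢.L.Op, ∃ t : Fm 𝓣.L (Fin (𝓢.L.arity f)), ∀ a, 𝒜 f a = t.eval ℬ a) :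
    𝓣.IsReducedModel ℬ F := by
  refine ⟨hm F hF.1 subset_rfl, fun a b hab => hF.2 a b fun G hG hFG => ?_⟩
  obtain ⟨θ, hθ, h⟩ := hab G (hm G hG hFG) hFG
  exact ⟨θ, hθ.of_terms ht, h⟩

end Congruence

theorem reduct_translate {L L' L'' : Language.{u}} {A : Type v} (ρ : Translation L L')
    (τ : Translation L' L'') (𝒜 : Alg L'' A) :
    Alg.reduct (fun f => (ρ f).translate τ) 𝒜 = Alg.reduct ρ (Alg.reduct τ 𝒜) :=
  funext fun f => funext fun a => Fm.eval_translate τ 𝒜 a (ρ f)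

/-- Interpretations turn all models, not only the reduced ones, into models. -/
theorem IsInterpretation.isModel {𝓢 𝓣 : Logic.{u}} {τ : Translation 𝓢.L 𝓣.L}
    (hτ : IsInterpretation 𝓢 𝓣 τ) {A : Type u} [Nonempty A] {𝒜 : Alg 𝓣.L A} {F : Set A}
    (hF : 𝓣.IsModel 𝒜 F) : 𝓢.IsModel (Alg.reduct τ 𝒜) F := by
  -- Membership in the filter is invariant under reduction, so it suffices to interpret the reduced
  -- quotient.
  have hc := isCongruence_leibnizSetoid 𝒜 F
  have : Nonempty (Quotient (leibnizSetoid 𝒜 F)) := ⟨⟦Classical.arbitrary A⟧⟩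
  have hq := (hτ _ _ _ hF.quotient).1
  have key : ∀ (v : 𝓢.Var → A) (φ : Fm 𝓢.L 𝓢.Var),
      φ.eval (Alg.reduct τ (Alg.quotient 𝒜 (leibnizSetoid 𝒜 F))) (fun x => ⟦v x⟧)
        ∈ {q : Quotient (leibnizSetoid 𝒜 F) | q.out ∈ F} ↔ φ.eval (Alg.reduct τ 𝒜) v ∈ F := by
    intro v φ
    rw [← Fm.eval_translate, hc.eval_quotient, Fm.eval_translate]
    exact ⟨mem_of_leibnizSetoid (Quotient.mk_out _),
      mem_of_leibnizSetoid ((leibnizSetoid 𝒜 F).symm (Quotient.mk_out _))⟩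
  intro Γ φ hφ v hv
  rw [← key]
  exact hq Γ φ hφ _ fun γ hγ => (key v γ).2 (hv γ hγ)

/-! ## Non-indexed products of logics -/

section Product

variable {ι : Type}

/-- The language whose `n`-ary symbols are the families of `n`-ary terms of the languages
`L i`. -/
abbrev prodLanguage (L : ι → Language.{u}) : Language.{u} where
  Op := Σ n : {n : ℕ // 0 < n}, ∀ i, Fm (L i) (Fin n)
  arity f := f.1
  arity_pos f := f.1.2

/-- The non-indexed product of a family of algebras. -/
def prodAlg {L : ι → Language.{u}} {A : ι → Type v} (𝒜 : ∀ i, Alg (L i) (A i)) :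
    Alg (prodLanguage L) (∀ i, A i) :=
  fun f a i => (f.2 i).eval (𝒜 i) fun k => a k i

/-- The projection of the product language onto a factor. -/
def projTranslation (L : ι → Language.{u}) (i : ι) : Translation (prodLanguage L) (L i) :=
  fun f => f.2 i

theorem eval_prodAlg {L : ι → Language.{u}} {A : ι → Type v} (𝒜 : ∀ i, Alg (L i) (A i))
    {X : Type w} (v : X → ∀ i, A i) (φ : Fm (prodLanguage L) X) (i : ι) :
    φ.eval (prodAlg 𝒜) v i
      = φ.eval (Alg.reduct (projTranslation L i) (𝒜 i)) fun x => v x i := by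
  induction φ with
  | var x => rfl
  | app f t ih =>
    change (f.2 i).eval (𝒜 i) _ = (f.2 i).eval (𝒜 i) _
    congr 1
    funext k
    exact ih k

/-- The logic of the non-indexed products of models of the logics `𝓢 i`. -/
abbrev Logic.prod [Nonempty ι] (𝓢 : ι → Logic.{u}) : Logic.{u} where
  L := prodLanguage fun i => (𝓢 i).L
  -- All rules of each factor can be written with these variables, and `none` is spare:
  -- `IsReducedModel.factor` uses it as an additional premise.
  Var := Option (Σ i, (𝓢 i).Var)
  infinite_var := by
    have i := Classical.arbitrary ι
    have := (𝓢 i).infinite_var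
    exact Infinite.of_injective (fun x => some ⟨i, x⟩)
      ((Option.some_injective _).comp sigma_mk_injective)
  Entails Γ φ := ∀ (A : ι → Type u) (𝒜 : ∀ i, Alg (𝓢 i).L (A i)) (F : ∀ i, Set (A i)),
    (∀ i, (𝓢 i).IsModel (𝒜 i) (F i)) → ∀ v : Option (Σ i, (𝓢 i).Var) → ∀ i, A i,
      (∀ γ ∈ Γ, ∀ i, γ.eval (prodAlg 𝒜) v i ∈ F i) → ∀ i, φ.eval (prodAlg 𝒜) v i ∈ F i
  entails_of_mem hφ _ _ _ _ _ hv := hv _ hφ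
  cut h h' A 𝒜 F hF v hv := h' A 𝒜 F hF v fun ψ hψ => h ψ hψ A 𝒜 F hF v hv
  entails_subst σ h A 𝒜 F hF v hv := by
    rw [Fm.eval_subst]
    refine h A 𝒜 F hF _ fun γ hγ => ?_
    rw [← Fm.eval_subst]
    exact hv _ (Set.mem_image_of_mem _ hγ)

/-- The identities of the non-indexed products hold in all reduced models of the product
logic. -/
theorem Logic.IsReducedModel.eval_eq_of_prod [Nonempty ι] {𝓢 : ι → Logic.{u}} {B : Type u}
    {ℬ : Alg (Logic.prod 𝓢).L B} {F : Set B} (hF : (Logic.prod 𝓢).IsReducedModel ℬ F)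
    {Y : Type w} {s t : Fm (Logic.prod 𝓢).L Y}
    (hst : ∀ (A : ι → Type u) (𝒜 : ∀ i, Alg (𝓢 i).L (A i)) (v : Y → ∀ i, A i),
      s.eval (prodAlg 𝒜) v = t.eval (prodAlg 𝒜) v) (v : Y → B) :
    s.eval ℬ v = t.eval ℬ v := by
  have key : ∀ G, (Logic.prod 𝓢).IsModel ℬ G → ∀ {s t : Fm (Logic.prod 𝓢).L Y},
      (∀ (A : ι → Type u) (𝒜 : ∀ i, Alg (𝓢 i).L (A i)) (v : Y → ∀ i, A i),
        s.eval (prodAlg 𝒜) v = t.eval (prodAlg 𝒜) v) → ∀ φ : Fm (Logic.prod 𝓢).L (Option B),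
      φ.eval ℬ (fun o => o.elim (s.eval ℬ v) id) ∈ G →
        φ.eval ℬ (fun o => o.elim (t.eval ℬ v) id) ∈ G := by
    intro G hG s t hst φ hφ
    -- Elements of `B` serve as variables. Then `plug s` and `plug t` take equal values in all
    -- products, so each entails the other in the product logic.
    let plug : Fm (Logic.prod 𝓢).L Y → Fm (Logic.prod 𝓢).L B := fun s =>
      φ.subst fun o => o.elim (s.subst fun y => .var (v y)) .var
    have hplug : ∀ s, (plug s).eval ℬ id = φ.eval ℬ fun o => o.elim (s.eval ℬ v) id := by
      intro s
      rw [Fm.eval_subst]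
      congr 1
      funext o
      cases o with
      | none => exact Fm.eval_subst _ _ _ _
      | some b => rfl
    rw [← hplug] at hφ ⊢
    refine hG.mem_of_entails (fun e A 𝒜 H hH w hw => ?_) id hφ
    have := hw _ rfl
    have heq : ((plug t).subst fun b => .var (e b)).eval (prodAlg 𝒜) w
        = ((plug s).subst fun b => .var (e b)).eval (prodAlg 𝒜) w := by
      rw [Fm.eval_subst, Fm.eval_subst, Fm.eval_subst, Fm.eval_subst]
      refine congrArg (fun p => φ.eval (prodAlg 𝒜) p) (funext fun o => ?_)
      cases o with
      | none =>
        change (t.subst _).eval _ _ = (s.subst _).eval _ _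
        rw [Fm.eval_subst, Fm.eval_subst]
        exact (hst _ _ _).symm
      | some b => rfl
    rwa [← heq] at this
  exact hF.2 _ _ fun G hG _ => leibniz_iff.2 fun φ =>
    ⟨key G hG hst φ, key G hG (fun A 𝒜 v => (hst A 𝒜 v).symm) φ⟩

variable [DecidableEq ι]

/-- The symbol of the product language that acts as the `n`-ary term `t` in the factor `i` and
as the first projection in the other factors. -/
def factorOp (L : ι → Language.{u}) (i : ι) (n : {n : ℕ // 0 < n}) (t : Fm (L i) (Fin n)) :
    (prodLanguage L).Op :=
  ⟨n, Function.update (fun _ => .var ⟨0, n.2⟩) i t⟩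

/-- The embedding of the language of a factor into the product language. -/
def factorTranslation (L : ι → Language.{u}) (i : ι) : Translation (L i) (prodLanguage L) :=
  fun f => .app (factorOp L i ⟨_, (L i).arity_pos f⟩ (.app f .var)) .var

/-- The binary symbol that takes the component `i` from its first argument and the other
components from its second one. -/
def mixOp (L : ι → Language.{u}) (i : ι) : (prodLanguage L).Op :=
  ⟨⟨2, Nat.zero_lt_two⟩, Function.update (fun _ => .var 1) i (.var 0)⟩

/-- The operation `mixOp` of an algebra. -/
def Alg.mix {L : ι → Language.{u}} {A : Type v} (𝒜 : Alg (prodLanguage L) A) (i : ι)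
    (a b : A) : A :=
  𝒜 (mixOp L i) (![a, b] : Fin 2 → A)

/-- The formula built from two formulas by means of `mixOp`. -/
def Fm.mix {L : ι → Language.{u}} {X : Type v} (i : ι) (s t : Fm (prodLanguage L) X) :
    Fm (prodLanguage L) X :=
  .app (mixOp L i) (![s, t] : Fin 2 → _)

theorem Fm.eval_mix {L : ι → Language.{u}} {A : Type v} (𝒜 : Alg (prodLanguage L) A)
    {X : Type w} (v : X → A) (i : ι) (s t : Fm (prodLanguage L) X) :
    (s.mix i t).eval 𝒜 v = 𝒜.mix i (s.eval 𝒜 v) (t.eval 𝒜 v) := by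
  change 𝒜 (mixOp L i) _ = 𝒜 (mixOp L i) _
  congr 1
  funext k
  change Fin 2 at k
  fin_cases k <;> rfl

theorem mix_prodAlg_same {L : ι → Language.{u}} {A : ι → Type v}
    (𝒜 : ∀ i, Alg (L i) (A i)) (i : ι) (a b : ∀ i, A i) :
    (prodAlg 𝒜).mix i a b i = a i := by
  simp [Alg.mix, prodAlg, mixOp, Fm.eval]

theorem mix_prodAlg_of_ne {L : ι → Language.{u}} {A : ι → Type v}
    (𝒜 : ∀ i, Alg (L i) (A i)) {i j : ι} (h : j ≠ i) (a b : ∀ i, A i) :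
    (prodAlg 𝒜).mix i a b j = b j := by
  simp [Alg.mix, prodAlg, mixOp, Fm.eval, h]

theorem factorOp_self (L : ι → Language.{u}) (i : ι) (n : {n : ℕ // 0 < n})
    (t : Fm (L i) (Fin n)) : (factorOp L i n t).2 i = t := by
  simp [factorOp]

theorem eval_factorOp_same {L : ι → Language.{u}} {A : ι → Type v}
    (𝒜 : ∀ i, Alg (L i) (A i)) (i : ι) (n : {n : ℕ // 0 < n}) (t : Fm (L i) (Fin n))
    (a : Fin n → ∀ i, A i) :
    prodAlg 𝒜 (factorOp L i n t) a i = t.eval (𝒜 i) fun k => a k i := by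
  simp [prodAlg, factorOp]

theorem eval_factorTranslation {L : ι → Language.{u}} {A : ι → Type v}
    (𝒜 : ∀ i, Alg (L i) (A i)) (i : ι) {X : Type w} (v : X → ∀ i, A i) (φ : Fm (L i) X) :
    φ.eval (Alg.reduct (factorTranslation L i) (prodAlg 𝒜)) v i
      = φ.eval (𝒜 i) fun x => v x i := by
  induction φ with
  | var x => rfl
  | app f t ih =>
    refine (eval_factorOp_same 𝒜 i _ _ _).trans ?_
    change 𝒜 i f _ = 𝒜 i f _
    congr 1
    funext k
    exact ih k

/-- A model of `𝓢 i` is multiplied by trivial models: a full filter is a model of any logic, so the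
other components impose nothing. -/
theorem Logic.prod_le [Nonempty ι] (𝓢 : ι → Logic.{u}) (i : ι) : Logic.prod 𝓢 ≤ 𝓢 i := by
  refine ⟨projTranslation _ i, fun A _ 𝒜 F hF => hF.of_terms (fun G hG _ => ?_) fun f => ?_⟩
  · intro Γ φ hφ v hv
    let 𝒜' : ∀ j, Alg (𝓢 j).L A :=
      Function.update (fun j f a => a ⟨0, (𝓢 j).L.arity_pos f⟩) i 𝒜
    let F' : ι → Set A := Function.update (fun _ => Set.univ) i G
    have hF' : ∀ j, (𝓢 j).IsModel (𝒜' j) (F' j) := by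
      intro j
      by_cases hj : j = i
      · subst hj
        simpa [𝒜', F'] using hG
      · intro _ _ _ _ _
        simp [F', hj]
    have hi : ∀ ψ : Fm (prodLanguage fun i => (𝓢 i).L) (Logic.prod 𝓢).Var,
        ψ.eval (prodAlg 𝒜') (fun x _ => v x) i
          = ψ.eval (Alg.reduct (projTranslation _ i) 𝒜) v := by
      intro ψ
      rw [eval_prodAlg]
      simp [𝒜']
    have h := hφ (fun _ => A) 𝒜' F' hF' (fun x _ => v x) ?_ i
    · rw [hi] at h
      simpa [F'] using h
    · intro γ hγ j
      by_cases hj : j = i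
      · subst hj
        rw [hi]
        simpa [F'] using hv γ hγ
      · simp [F', hj]
  · refine ⟨.app (factorOp (fun i => (𝓢 i).L) i ⟨_, (𝓢 i).L.arity_pos f⟩ (.app f .var)) .var,
      fun a => ?_⟩
    refine Eq.symm ((congrArg (fun t : Fm (𝓢 i).L (Fin ((𝓢 i).L.arity f)) => t.eval 𝒜 a)
      (factorOp_self (fun i => (𝓢 i).L) i _ _)).trans rfl)

/-- A reduced model of the product logic in which the operation `mixOp i` is the first
projection is a reduced model of the factor `i`. -/
theorem Logic.IsReducedModel.factor [Nonempty ι] {𝓢 : ι → Logic.{u}} {i : ι} {B : Type u}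
    {ℬ : Alg (Logic.prod 𝓢).L B} {F : Set B} (hF : (Logic.prod 𝓢).IsReducedModel ℬ F)
    (hne : F.Nonempty) (hmix : ∀ a b : B, Alg.mix (L := fun i => (𝓢 i).L) ℬ i a b = a) :
    (𝓢 i).IsReducedModel (Alg.reduct (factorTranslation (fun i => (𝓢 i).L) i) ℬ) F := by
  refine hF.of_terms (fun G hG hFG => ?_) fun f => ⟨f.2 i, fun a => ?_⟩
  · intro Γ φ hφ v hv
    obtain ⟨g, hg⟩ := hne
    let e : (𝓢 i).Var → (Logic.prod 𝓢).Var := fun x => some ⟨i, x⟩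
    have he : Function.Injective e := (Option.some_injective _).comp sigma_mk_injective
    let star : Fm (𝓢 i).L (𝓢 i).Var → Fm (Logic.prod 𝓢).L (Logic.prod 𝓢).Var := fun ψ =>
      (ψ.translate (factorTranslation (fun i => (𝓢 i).L) i)).subst fun x => .var (e x)
    have hstar : ∀ {C : Type u} (𝒞 : Alg (Logic.prod 𝓢).L C) (w : (Logic.prod 𝓢).Var → C) ψ,
        (star ψ).eval 𝒞 w
          = ψ.eval (Alg.reduct (factorTranslation (fun i => (𝓢 i).L) i) 𝒞)
            fun x => w (e x) := by
      intro C 𝒞 w ψ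
      rw [Fm.eval_subst, Fm.eval_translate]
      rfl
    -- In the components other than `i` the conclusion reduces to the premise `none`, so the rule is
    -- sound in products. In `ℬ` it becomes `φ` itself, and `none` is given a designated value; this
    -- is where `F` must be non-empty.
    let concl : Fm (Logic.prod 𝓢).L (Logic.prod 𝓢).Var :=
      (star φ).mix (L := fun i => (𝓢 i).L) i (.var none)
    have hent : (Logic.prod 𝓢).Entails (insert (.var none) (star '' Γ)) concl := by
      intro A 𝒜 H hH w hw j
      by_cases hj : j = i
      · subst hj
        rw [Fm.eval_mix, mix_prodAlg_same, hstar, eval_factorTranslation]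
        refine hH j Γ φ hφ _ fun γ hγ => ?_
        have := hw (star γ) (Set.mem_insert_of_mem _ (Set.mem_image_of_mem _ hγ)) j
        rwa [hstar, eval_factorTranslation] at this
      · rw [Fm.eval_mix, mix_prodAlg_of_ne _ hj]
        exact hw _ (Set.mem_insert _ _) j
    let w : (Logic.prod 𝓢).Var → B := Function.extend e v fun _ => g
    have hw : (fun x => w (e x)) = v := funext fun x => he.extend_apply _ _ x
    have hconcl := hG _ _ hent w ?_
    · rwa [Fm.eval_mix, hmix, hstar, hw] at hconcl
    · rintro γ (rfl | ⟨γ, hγ, rfl⟩)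
      · have : w none = g := Function.extend_apply' _ _ _ (by rintro ⟨x, hx⟩; cases hx)
        change w none ∈ G
        rw [this]
        exact hFG hg
      · rw [hstar, hw]
        exact hv γ hγ
  -- In products `f` and `T` agree in component `i`, so mixing `f` with `T` yields `T`; in `ℬ` the
  -- mixture is `f`.
  · let T : Fm (Logic.prod 𝓢).L (Fin f.1) :=
      (f.2 i).translate (factorTranslation (fun i => (𝓢 i).L) i)
    have h := hF.eval_eq_of_prod
      (s := Fm.mix (L := fun i => (𝓢 i).L) i (.app f .var) T) (t := T) ?_ a
    · rw [Fm.eval_mix, hmix, Fm.eval_translate] at h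
      exact h
    · intro A 𝒜 v
      funext j
      by_cases hj : j = i
      · subst hj
        rw [Fm.eval_mix, mix_prodAlg_same, Fm.eval_translate, eval_factorTranslation]
        rfl
      · rw [Fm.eval_mix, mix_prodAlg_of_ne _ hj]

end Product

/-- A logic with theorems whose only idempotent binary terms are variables is meet-prime. -/
theorem Logic.meetPrime_of_idempotent {𝓟 : Logic.{u}}
    (hne : ∀ (A : Type u) [Nonempty A] (𝒜 : Alg 𝓟.L A) (F : Set A),
      𝓟.IsReducedModel 𝒜 F → F.Nonempty)
    (hidem : ∀ t : Fm 𝓟.L (Fin 2),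
      (∀ (A : Type u) [Nonempty A] (𝒜 : Alg 𝓟.L A) (F : Set A), 𝓟.IsReducedModel 𝒜 F →
        ∀ a : A, t.eval 𝒜 (fun _ => a) = a) → ∃ k, t = .var k) :
    𝓟.MeetPrime := by
  intro b c
  induction b using Antisymmetrization.ind with | _ 𝓑
  induction c using Antisymmetrization.ind with | _ 𝓒
  intro h
  let 𝓢 : Bool → Logic.{u} := fun i => cond i 𝓑 𝓒
  obtain ⟨τ, hτ⟩ : Logic.prod 𝓢 ≤ 𝓟 :=
    h (Logic.prod 𝓢).toLog (Logic.prod_le 𝓢 true) (Logic.prod_le 𝓢 false)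
  have le_of_mix : ∀ i, (∀ (A : Type u) [Nonempty A] (𝒜 : Alg 𝓟.L A) (F : Set A),
      𝓟.IsReducedModel 𝒜 F → ∀ a b : A,
        Alg.mix (L := fun i => (𝓢 i).L) (Alg.reduct τ 𝒜) i a b = a) → 𝓢 i ≤ 𝓟 := by
    intro i hi
    refine ⟨fun f => (factorTranslation (fun i => (𝓢 i).L) i f).translate τ,
      fun A _ 𝒜 F hF => ?_⟩
    rw [reduct_translate]
    exact (hτ A 𝒜 F hF).factor (hne A 𝒜 F hF) (hi A 𝒜 F hF)
  obtain ⟨k, hk⟩ := hidem (τ (mixOp (fun i => (𝓢 i).L) true)) (by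
    intro A _ 𝒜 F hF a
    have h := (hτ A 𝒜 F hF).eval_eq_of_prod (Y := Unit)
      (s := Fm.mix (L := fun i => (𝓢 i).L) true (.var ()) (.var ())) (t := .var ()) ?_ fun _ => a
    · rw [Fm.eval_mix] at h
      refine Eq.trans ?_ h
      change _ = (τ (mixOp (fun i => (𝓢 i).L) true)).eval 𝒜 ![a, a]
      congr 1
      funext k
      fin_cases k <;> rfl
    · intro A 𝒜 v
      funext j
      rw [Fm.eval_mix]
      by_cases hj : j = true
      · subst hj
        rw [mix_prodAlg_same]
      · rw [mix_prodAlg_of_ne _ hj])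
  have htrue : ∀ (A : Type u) (𝒜 : Alg 𝓟.L A) (a b : A),
      Alg.mix (L := fun i => (𝓢 i).L) (Alg.reduct τ 𝒜) true a b = ![a, b] k := by
    intro A 𝒜 a b
    change (τ (mixOp (fun i => (𝓢 i).L) true)).eval 𝒜 ![a, b] = _
    rw [hk]
    rfl
  obtain rfl | rfl : k = 0 ∨ k = 1 := by omega
  · exact Or.inl (le_of_mix true fun A _ 𝒜 F _ a b => htrue A 𝒜 a b)
  -- In products, mixing at `false` is mixing at `true` with the arguments swapped. As the latter is
  -- the second projection here, the former is the first.
  · refine Or.inr (le_of_mix false fun A _ 𝒜 F hF a b => ?_)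
    have := (hτ A 𝒜 F hF).eval_eq_of_prod (Y := Fin 2)
      (s := Fm.mix (L := fun i => (𝓢 i).L) false (.var 0) (.var 1))
      (t := Fm.mix (L := fun i => (𝓢 i).L) true (.var 1) (.var 0)) ?_ ![a, b]
    · rw [Fm.eval_mix, Fm.eval_mix] at this
      exact this.trans (htrue A 𝒜 _ _)
    · intro A 𝒜 v
      funext j
      rw [Fm.eval_mix, Fm.eval_mix]
      cases j with
      | false => rw [mix_prodAlg_same, mix_prodAlg_of_ne _ (by decide)]
      | true => rw [mix_prodAlg_same, mix_prodAlg_of_ne _ (by decide)]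

/-! ## The basic protoalgebraic logics -/

section Proto

/-- The basic protoalgebraic logic with index set `K`. -/
abbrev protoLogic (K : Type u) : Logic.{u} where
  L := protoLanguage K
  Var := ULift.{u} ℕ
  infinite_var := inferInstance
  Entails := Derives (protoRules ⟨0⟩ ⟨1⟩)
  entails_of_mem := Derives.hyp
  cut := (Logic.ofRules (protoLanguage K) (ULift.{u} ℕ) inferInstance _).cut
  entails_subst := (Logic.ofRules (protoLanguage K) (ULift.{u} ℕ) inferInstance _).entails_subst

/-- The operation `⊸_α` of an algebra. -/
def Alg.imp {K : Type u} {A : Type v} (𝒜 : Alg (protoLanguage K) A) (α : K) (a b : A) : A :=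
  𝒜 (ProtoOp.imp α) ![a, b]

theorem eval_protoImp {K : Type u} {A : Type v} (𝒜 : Alg (protoLanguage K) A) {X : Type w}
    (v : X → A) (α : K) (φ ψ : Fm (protoLanguage K) X) :
    (protoImp α φ ψ).eval 𝒜 v = 𝒜.imp α (φ.eval 𝒜 v) (ψ.eval 𝒜 v) := by
  change 𝒜 (ProtoOp.imp α) _ = 𝒜 (ProtoOp.imp α) _
  congr 1
  funext i
  change Fin 2 at i
  fin_cases i <;> rfl

theorem isModel_protoLogic_iff {K : Type u} {A : Type v} {𝒜 : Alg (protoLanguage K) A}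
    {F : Set A} : (protoLogic K).IsModel 𝒜 F ↔ (∀ α a, 𝒜.imp α a a ∈ F) ∧
      ∀ a b, a ∈ F → (∀ α, 𝒜.imp α a b ∈ F) → b ∈ F := by
  constructor
  · intro h
    have hent : ∀ r ∈ protoRules (K := K) (X := ULift.{u} ℕ) ⟨0⟩ ⟨1⟩,
        (protoLogic K).Entails r.1 r.2 := by
      intro r hr
      have hvar : ∀ φ : Fm (protoLanguage K) (ULift.{u} ℕ), φ.subst .var = φ := by
        intro φ
        induction φ with
        | var x => rfl
        | app f t ih => exact congrArg (Fm.app f) (funext ih)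
      have := Derives.rule (Γ := r.1) .var hr fun δ hδ => by
        rw [hvar]
        exact Derives.hyp hδ
      rwa [hvar] at this
    constructor
    · intro α a
      have := h _ _ (hent (∅, protoImp α (.var ⟨0⟩) (.var ⟨0⟩)) (Or.inl ⟨rfl, α, rfl⟩))
        (fun _ => a) (fun _ h => h.elim)
      exact (congrArg (· ∈ F) (eval_protoImp 𝒜 (fun _ => a) α _ _)).mp this
    · intro a b ha hab
      refine h _ _ (hent _ (Or.inr rfl)) (fun n => if n.down = 0 then a else b) ?_
      rintro γ (rfl | ⟨α, rfl⟩)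
      · exact ha
      · exact (eval_protoImp 𝒜 _ α _ _).symm ▸ hab α
  · rintro ⟨h1, h2⟩ Γ φ hφ v hv
    induction hφ with
    | hyp h => exact hv _ h
    | rule σ hr _ ih =>
      rcases hr with ⟨-, α, hα⟩ | rfl
      · rw [← hα, Fm.eval_subst]
        exact (eval_protoImp 𝒜 _ α _ _).symm ▸ h1 α _
      · refine h2 _ _ (ih _ (Set.mem_insert _ _)) fun α => ?_
        have := ih _ (Set.mem_insert_of_mem _ ⟨α, rfl⟩)
        rw [Fm.eval_subst] at this
        rw [Fm.eval_subst, Fm.eval_subst]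
        exact (eval_protoImp 𝒜 _ α _ _) ▸ this

theorem protoImp_inj {K : Type u} {X : Type v} {α β : K} {φ ψ φ' ψ' : Fm (protoLanguage K) X}
    (h : protoImp α φ ψ = protoImp β φ' ψ') : φ = φ' ∧ ψ = ψ' := by
  unfold protoImp at h
  injection h with h1 h2
  cases h1
  exact ⟨congrFun h2 (0 : Fin 2), congrFun h2 (1 : Fin 2)⟩

/-- The formulas `φ ⊸_α φ` form a filter of the formula algebra with trivial Leibniz
congruence. -/
theorem isReducedModel_formulas {K : Type u} [Nonempty K] (X : Type v) :
    (protoLogic K).IsReducedModel (A := Fm (protoLanguage K) X) (fun f t => .app f t)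
      {χ | ∃ α φ, χ = protoImp α φ φ} := by
  have hm : (protoLogic K).IsModel (A := Fm (protoLanguage K) X) (fun f t => .app f t)
      {χ | ∃ α φ, χ = protoImp α φ φ} := by
    refine isModel_protoLogic_iff.2 ⟨fun α φ => ⟨α, φ, rfl⟩, fun φ ψ hφ h => ?_⟩
    -- Unique readability: if `φ ⊸ ψ` has the form `χ ⊸ χ`, then `φ = ψ`.
    obtain ⟨β, χ, h⟩ := h (Classical.arbitrary K)
    obtain ⟨h1, h2⟩ := protoImp_inj h
    rwa [h2, ← h1]
  refine ⟨hm, fun φ ψ h => ?_⟩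
  obtain ⟨θ, hθ, hF, hφψ⟩ := h _ hm subset_rfl
  let α := Classical.arbitrary K
  -- Compatibility carries `φ ⊸_α φ` to `φ ⊸_α ψ`, which is in the filter only if `φ = ψ`.
  obtain ⟨β, χ, h⟩ := hF (protoImp α φ φ) (protoImp α φ ψ) (by
    refine hθ (ProtoOp.imp α) _ _ fun i => ?_
    change Fin 2 at i
    fin_cases i
    · exact θ.refl _
    · exact hφψ) ⟨α, φ, rfl⟩
  obtain ⟨h1, h2⟩ := protoImp_inj h
  rw [h1, h2]

theorem protoLogic_meetPrime (K : Type u) [Nonempty K] : (protoLogic K).MeetPrime := by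
  refine Logic.meetPrime_of_idempotent (fun A _ 𝒜 F hF => ?_) fun t ht => ?_
  · exact ⟨_, (isModel_protoLogic_iff.1 hF.1).1 (Classical.arbitrary K) (Classical.arbitrary A)⟩
  · have : Nonempty (Fm (protoLanguage K) PUnit.{u + 1}) := ⟨.var ⟨⟩⟩
    have h := ht _ _ _ (isReducedModel_formulas PUnit.{u + 1}) (.var ⟨⟩)
    cases t with
    | var k => exact ⟨k, rfl⟩
    | app f t => cases h

/-- The basic protoalgebraic logics decrease when the index set grows. -/
theorem protoLogic_le_of_surjective {K K' : Type u} {g : K' → K} (hg : Function.Surjective g) :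
    protoLogic K' ≤ protoLogic K := by
  let τ : Translation (protoLanguage K') (protoLanguage K)
    | .imp α => Fm.app (L := protoLanguage K) (.imp (g α)) Fm.var
    | .star n α => Fm.app (L := protoLanguage K) (.star n (g α)) Fm.var
  refine ⟨τ, fun A _ 𝒜 F hF => hF.of_terms (fun G hG _ => ?_) ?_⟩
  · rw [isModel_protoLogic_iff] at hG ⊢
    refine ⟨fun α a => hG.1 (g α) a, fun a b ha h => hG.2 a b ha fun β => ?_⟩
    obtain ⟨α, rfl⟩ := hg β
    exact h α
  · rintro (β | ⟨n, β⟩)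
    · obtain ⟨α, rfl⟩ := hg β
      exact ⟨Fm.app (L := protoLanguage K') (.imp α) Fm.var, fun a => rfl⟩
    · obtain ⟨α, rfl⟩ := hg β
      exact ⟨Fm.app (L := protoLanguage K') (.star n α) Fm.var, fun a => rfl⟩

/-! ## Protoalgebraic logics -/

theorem protoalgebraic_of_protoLogic_le {K : Type u} [Nonempty K] {𝓢 : Logic.{u}}
    (h : protoLogic K ≤ 𝓢) : 𝓢.Protoalgebraic := by
  obtain ⟨τ, hτ⟩ := h
  have := 𝓢.infinite_var
  obtain ⟨x, y, hxy⟩ := exists_pair_ne 𝓢.Var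
  let imp : K → Fm 𝓢.L 𝓢.Var → Fm 𝓢.L 𝓢.Var → Fm 𝓢.L 𝓢.Var := fun α φ ψ =>
    (τ (ProtoOp.imp α)).subst ![φ, ψ]
  have himp : ∀ {A : Type u} (𝒜 : Alg 𝓢.L A) (v : 𝓢.Var → A) α φ ψ,
      (imp α φ ψ).eval 𝒜 v
        = Alg.imp (Alg.reduct τ 𝒜 : Alg (protoLanguage K) A) α (φ.eval 𝒜 v) (ψ.eval 𝒜 v) := by
    intro A 𝒜 v α φ ψ
    refine (Fm.eval_subst _ _ _ _).trans ?_
    change _ = (τ (ProtoOp.imp α)).eval 𝒜 _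
    congr 1
    funext i
    change Fin 2 at i
    fin_cases i <;> rfl
  let plug : Fm 𝓢.L (Option 𝓢.Var) → 𝓢.Var → Fm 𝓢.L 𝓢.Var := fun φ z =>
    φ.subst fun o => .var (o.elim z id)
  have hplug : ∀ {A : Type u} (𝒜 : Alg 𝓢.L A) (v : 𝓢.Var → A) φ z,
      (plug φ z).eval 𝒜 v = φ.eval 𝒜 fun o => o.elim (v z) v := by
    intro A 𝒜 v φ z
    refine (Fm.eval_subst _ _ _ _).trans ?_
    congr 1
    funext o
    cases o <;> rfl
  refine ⟨x, y, {δ | ∃ α φ, δ = imp α (plug φ x) (plug φ y) ∨ δ = imp α (plug φ y) (plug φ x)},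
    hxy, ⟨_, Classical.arbitrary K, .var none, Or.inl rfl⟩, ?_⟩
  intro A _ 𝒜 F hF a b
  obtain ⟨h1, h2⟩ := isModel_protoLogic_iff.1 (hτ.isModel hF)
  constructor
  · rintro ⟨θ, hθ, hθF, hab⟩ v hx hy δ ⟨α, φ, hδ⟩
    have hφ : θ ((plug φ x).eval 𝒜 v) ((plug φ y).eval 𝒜 v) := by
      rw [hplug, hplug]
      refine hθ.eval (fun o => ?_) φ
      cases o with
      | none => rwa [← hx, ← hy] at hab
      | some z => exact θ.refl _
    have key : ∀ {c d}, θ c d →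
        Alg.imp (Alg.reduct τ 𝒜 : Alg (protoLanguage K) A) α c d ∈ F := by
      intro c d hcd
      refine hθF _ _ (hθ.eval (fun i => ?_) (τ (ProtoOp.imp α))) (h1 α c)
      change Fin 2 at i
      fin_cases i
      · exact θ.refl _
      · exact hcd
    rcases hδ with rfl | rfl
    · rw [himp]
      exact key hφ
    · rw [himp]
      exact key (θ.symm hφ)
  · intro h
    refine leibniz_iff.2 fun φ => ?_
    -- The polynomial `φ` has finitely many parameters in `A`; they become values of variables while
    -- `x` and `y` keep the values `a` and `b`.
    have hfin : {c : A | some c ∈ φ.vars}.Finite :=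
      φ.finite_vars.preimage (Option.some_injective _).injOn
    classical
    obtain ⟨e, v, hv, hw⟩ := exists_renaming (X := 𝓢.Var) hfin
      (Set.toFinite {x, y}) id (fun z => if z = x then a else b)
    have hx : v x = a := by simpa using hw x (by simp)
    have hy : v y = b := by simpa [hxy.symm] using hw y (by simp)
    let ψ : Fm 𝓢.L (Option 𝓢.Var) := φ.subst fun o => .var (o.map e)
    have hψ : ∀ z, (plug ψ z).eval 𝒜 v = φ.eval 𝒜 fun o => o.elim (v z) id := by
      intro z
      rw [hplug]
      refine (Fm.eval_subst _ _ _ _).trans (Fm.eval_congr _ fun o ho => ?_)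
      cases o with
      | none => rfl
      | some c => exact hv c ho
    rw [← hx, ← hy, ← hψ, ← hψ]
    constructor
    · intro hm
      refine h2 _ _ hm fun α => ?_
      refine (himp 𝒜 v α _ _) ▸ ?_
      exact h v hx hy _ ⟨α, ψ, Or.inl rfl⟩
    · intro hm
      refine h2 _ _ hm fun α => ?_
      refine (himp 𝒜 v α _ _) ▸ ?_
      exact h v hx hy _ ⟨α, ψ, Or.inr rfl⟩

/-- The consequences of a set of formulas form a filter of the formula algebra. -/
theorem Logic.isModel_consequences (𝓢 : Logic.{u}) (Γ : Set (Fm 𝓢.L 𝓢.Var)) :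
    𝓢.IsModel (fun f t => Fm.app f t) {φ | 𝓢.Entails Γ φ} := by
  intro Δ φ h v hv
  refine 𝓢.cut ?_ (𝓢.entails_subst v h)
  rintro _ ⟨δ, hδ, rfl⟩
  exact hv δ hδ

/-- The binary terms `t` such that `t(x, x)` is always designated. -/
def Logic.reflexiveTerms (𝓢 : Logic.{u}) : Set (Fm 𝓢.L (Fin 2)) :=
  {t | ∀ z : 𝓢.Var, 𝓢.Entails ∅ (t.subst fun _ => .var z)}

/-- Every element is Leibniz-related to itself, so identifying all variables of a congruence formula
gives a theorem. -/
theorem Logic.Protoalgebraic.reflexiveTerms_nonempty {𝓢 : Logic.{u}} (h : 𝓢.Protoalgebraic) :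
    𝓢.reflexiveTerms.Nonempty := by
  obtain ⟨x, y, Δ, -, ⟨δ, hδ⟩, h⟩ := h
  have : Nonempty (Fm 𝓢.L 𝓢.Var) := ⟨.var x⟩
  refine ⟨δ.subst fun _ => .var 0, fun z => ?_⟩
  rw [Fm.subst_subst]
  exact (h _ _ _ (𝓢.isModel_consequences ∅) (.var z) (.var z)).1
    (leibniz_iff.2 ((leibnizSetoid _ _).refl _)) _ rfl rfl δ hδ

/-- The reflexive binary terms satisfy modus ponens. -/
theorem Logic.Protoalgebraic.mem_of_reflexiveTerms {𝓢 : Logic.{u}} (h : 𝓢.Protoalgebraic)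
    {A : Type v} {𝒜 : Alg 𝓢.L A} {F : Set A} (hF : 𝓢.IsModel 𝒜 F) {a b : A} (ha : a ∈ F)
    (hab : ∀ t ∈ 𝓢.reflexiveTerms, t.eval 𝒜 ![a, b] ∈ F) : b ∈ F := by
  classical
  obtain ⟨x, y, Δ, hxy, -, h⟩ := h
  have : Nonempty (Fm 𝓢.L 𝓢.Var) := ⟨.var x⟩
  let σ : 𝓢.Var → Fm 𝓢.L 𝓢.Var := fun z => if z = y then .var x else .var z
  let T : Set (Fm 𝓢.L 𝓢.Var) := {φ | 𝓢.Entails ∅ (φ.subst σ)}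
  have hT : 𝓢.IsModel (fun f t => Fm.app f t) T := by
    intro Γ φ hφ v hv
    have h := 𝓢.isModel_consequences ∅ Γ φ hφ (fun z => (v z).subst σ) fun γ hγ => by
      change 𝓢.Entails ∅ (γ.subst fun z => (v z).subst σ)
      rw [← Fm.subst_subst]
      exact hv γ hγ
    change 𝓢.Entails ∅ (φ.subst fun z => (v z).subst σ) at h
    rwa [← Fm.subst_subst] at h
  -- The kernel of `σ` is a congruence compatible with `T`, and it identifies `x` with `y`.
  have hTxy : Leibniz (fun f t => Fm.app f t) T (.var x) (.var y) := by
    refine ⟨⟨fun φ ψ => φ.subst σ = ψ.subst σ, fun _ => rfl, Eq.symm, Eq.trans⟩, ?_, ?_, ?_⟩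
    · intro f s t hst
      exact congrArg (Fm.app f) (funext hst)
    · intro φ ψ hφψ hφ
      change 𝓢.Entails ∅ _
      rw [← show φ.subst σ = ψ.subst σ from hφψ]
      exact hφ
    · change σ x = σ y
      simp [σ]
  -- The instances of `Δ` for `x` and `y` lie in `T`, hence in the theory generated by `x` and `T`;
  -- that theory therefore cannot separate `x` from `y`.
  have hent : 𝓢.Entails (insert (.var x) T) (.var y) := by
    have hle : T ⊆ {φ | 𝓢.Entails (insert (.var x) T) φ} := fun φ hφ =>
      𝓢.entails_of_mem (Set.mem_insert_of_mem _ hφ)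
    obtain ⟨θ, -, hθ, hθxy⟩ := (h _ _ _ (𝓢.isModel_consequences (insert (.var x) T))
      (.var x) (.var y)).2 fun v hx hy δ hδ => hle ((h _ _ _ hT _ _).1 hTxy v hx hy δ hδ)
    exact hθ _ _ hθxy (𝓢.entails_of_mem (Set.mem_insert _ _))
  have hy := hF _ _ hent (fun z => if z = y then b else a) ?_
  · simpa [Fm.eval] using hy
  · rintro φ (rfl | hφ)
    · simpa [Fm.eval, hxy] using ha
    -- The assignment sends `y` to `b` and all other variables to `a`, so a member of `T` acts as a
    -- reflexive binary term.
    · let t : Fm 𝓢.L (Fin 2) := φ.subst fun z => .var (if z = y then 1 else 0)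
      have ht : t ∈ 𝓢.reflexiveTerms := by
        intro z
        have := 𝓢.entails_subst (fun _ => .var z) hφ
        rw [Set.image_empty, Fm.subst_subst] at this
        rw [Fm.subst_subst]
        convert this using 2
        funext w
        by_cases hw : w = y <;> simp [σ, hw, Fm.subst, Fm.eval]
      have := hab t ht
      rw [Fm.eval_subst] at this
      convert this using 2
      funext z
      by_cases hz : z = y <;> simp [hz, Fm.eval]

theorem Logic.Protoalgebraic.protoLogic_le {𝓢 : Logic.{u}} (h : 𝓢.Protoalgebraic) {K : Type u}
    {imp : K → Fm 𝓢.L (Fin 2)} (himp : Set.range imp = 𝓢.reflexiveTerms)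
    {star : ∀ n : ℕ, K → Fm 𝓢.L (Fin (n + 1))} (hstar : ∀ n, Function.Surjective (star n)) :
    protoLogic K ≤ 𝓢 := by
  let τ : Translation (protoLanguage K) 𝓢.L
    | .imp α => imp α
    | .star n α => star n α
  refine ⟨τ, fun A _ 𝒜 F hF => hF.of_terms (fun G hG _ => ?_) fun f => ?_⟩
  · refine isModel_protoLogic_iff.2 ⟨fun α a => ?_, fun a b ha hab => ?_⟩
    · have hα : imp α ∈ 𝓢.reflexiveTerms := himp ▸ Set.mem_range_self α
      have := 𝓢.infinite_var
      have := hG _ _ (hα (Classical.arbitrary _)) (fun _ => a) (fun _ h => h.elim)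
      rw [Fm.eval_subst] at this
      change (imp α).eval 𝒜 ![a, a] ∈ G
      convert this using 2
      funext i
      fin_cases i <;> rfl
    · refine h.mem_of_reflexiveTerms hG ha fun t ht => ?_
      obtain ⟨α, rfl⟩ := himp.symm ▸ ht
      exact hab α
  -- Some `∗` symbol translates to the basic operation `f`, so every operation of `𝒜` is a term
  -- operation of the reduct.
  · obtain ⟨n, hn⟩ : ∃ n, 𝓢.L.arity f = n + 1 :=
      Nat.exists_eq_succ_of_ne_zero (𝓢.L.arity_pos f).ne'
    obtain ⟨α, hα⟩ := hstar n (.app f fun i => .var (Fin.cast hn i))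
    refine ⟨Fm.app (L := protoLanguage K) (.star n α) fun i => .var (Fin.cast hn.symm i),
      fun a => ?_⟩
    change _ = (star n α).eval 𝒜 _
    rw [hα]
    rfl

theorem Logic.Protoalgebraic.exists_aleph {𝓢 : Logic.{u}} (h : 𝓢.Protoalgebraic) :
    ∃ α : Ordinal.{u}, basicProto (Cardinal.aleph α) ≤ 𝓢 := by
  -- A bound for the number of terms of all arities at once, made infinite so that it is an aleph.
  let c : Cardinal.{u} := max Cardinal.aleph0 (Cardinal.mk (Σ n : ℕ, Fm 𝓢.L (Fin n)))
  obtain ⟨α, hα⟩ : c ∈ Set.range Cardinal.aleph :=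
    Cardinal.mem_range_aleph_iff.2 (le_max_left _ _)
  have hsurj : ∀ (n : ℕ) (S : Set (Fm 𝓢.L (Fin n))), S.Nonempty →
      ∃ g : (Cardinal.aleph α).ord.ToType → Fm 𝓢.L (Fin n), Set.range g = S := by
    intro n S hS
    have hle : Cardinal.mk S ≤ Cardinal.mk (Cardinal.aleph α).ord.ToType := by
      rw [Cardinal.mk_ord_toType, hα]
      refine le_trans ?_ (le_max_right _ _)
      exact Cardinal.mk_le_of_injective (f := fun s : S => ⟨n, s.1⟩)
        (sigma_mk_injective.comp Subtype.val_injective)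
    have : Nonempty S := hS.to_subtype
    obtain ⟨e⟩ := hle
    refine ⟨fun k => (Function.invFun e k : S), Set.ext fun t => ⟨?_, fun ht => ?_⟩⟩
    · rintro ⟨k, rfl⟩
      exact (Function.invFun e k).2
    · obtain ⟨k, hk⟩ := Function.invFun_surjective e.injective ⟨t, ht⟩
      exact ⟨k, congrArg Subtype.val hk⟩
  obtain ⟨imp, himp⟩ := hsurj 2 _ h.reflexiveTerms_nonempty
  have hstar := fun n => hsurj (n + 1) Set.univ ⟨.var 0, trivial⟩
  choose star hstar using hstar
  exact ⟨α, h.protoLogic_le himp fun n => Set.range_eq_univ.1 (hstar n)⟩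

theorem nonempty_toType_ord {κ : Cardinal.{u}} (hκ : Cardinal.aleph0 ≤ κ) :
    Nonempty κ.ord.ToType := by
  rw [← Cardinal.mk_ne_zero_iff, Cardinal.mk_ord_toType]
  exact (Cardinal.aleph0_pos.trans_le hκ).ne'

theorem basicProto_meetPrime {κ : Cardinal.{u}} (hκ : Cardinal.aleph0 ≤ κ) :
    (basicProto κ).MeetPrime := by
  have := nonempty_toType_ord hκ
  exact protoLogic_meetPrime κ.ord.ToType

theorem basicProto_anti {κ μ : Cardinal.{u}} (hκ : Cardinal.aleph0 ≤ κ) (h : κ ≤ μ) :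
    basicProto μ ≤ basicProto κ := by
  have := nonempty_toType_ord hκ
  rw [← Cardinal.mk_ord_toType κ, ← Cardinal.mk_ord_toType μ] at h
  obtain ⟨e⟩ := h
  exact protoLogic_le_of_surjective (Function.invFun_surjective e.injective)

end Proto

end LeibnizHierarchy

theorem theorem7p2 :
    (∀ κ : Cardinal.{u}, Cardinal.aleph0 ≤ κ →
      (LeibnizHierarchy.basicProto κ).MeetPrime) ∧
    ∃ Φ : LeibnizHierarchy.LeibnizCondition.{u},
      (∀ α : Ordinal.{u}, (Φ.seq α).MeetPrime) ∧
      Φ.logics = {𝓢 : LeibnizHierarchy.Logic.{u} | 𝓢.Protoalgebraic} := by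
  refine ⟨fun κ => LeibnizHierarchy.basicProto_meetPrime,
    ⟨fun α => LeibnizHierarchy.basicProto (Cardinal.aleph α), fun α β h =>
      LeibnizHierarchy.basicProto_anti (Cardinal.aleph0_le_aleph α)
        (Cardinal.aleph_le_aleph.2 h)⟩,
    fun α => LeibnizHierarchy.basicProto_meetPrime (Cardinal.aleph0_le_aleph α),
    Set.ext fun 𝓢 => ⟨?_, fun h => h.exists_aleph⟩⟩
  rintro ⟨α, h⟩
  have := LeibnizHierarchy.nonempty_toType_ord (Cardinal.aleph0_le_aleph α)
  exact LeibnizHierarchy.protoalgebraic_of_protoLogic_le h
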